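/- Setting. Let $(\Omega,\mathcal P)$ be a probability space and $0<A<B<1$. Let $(a_n,b_n)_{n\ge1}$ be independent, identically distributed random pairs with values in $\{(x,y)\in[0,1]^2: A\le\min(x,y)<x+y\le B\}$, and let $(p_n)_{n\ge 1}$ be i.i.d. random variables in $[0,1]$, independent of $(a_n,b_n)_{n\ge1}$, such that for some $t>0$ the expectations $\mathbb E(a_1^{-t})$, $\mathbb E(b_1^{-t})$, $\mathbb E(p_1^{-t})$ and $\mathbb E((1-p_1)^{-t})$ are finite. For $\omega\in\Omega$ define the Moran intervals of step $n$ inductively: the only Moran interval of step $0$ is $[0,1]$, and each Moran interval $I$ of step $n-1$ has two children of step $n$, namely the left-most closed subinterval of $I$ of length $a_n(\omega)|I|$ and the right-most closed subinterval of $I$ of length $b_n(\omega)|I|$. Let $\mu_\omega$ be the Borel probability measure determined by $\mu_\omega([0,1])=1$ and the rule that, if $I$ is a Moran interval of step $n-1$, then its left child has measure $p_n(\omega)\mu_\omega(I)$ and its right child has measure $(1-p_n(\omega))\mu_\omega(I)$. For a finite Borel measure $\mu$ on a metric space (with $B(x,r)$ the open ball), the (upper) Assouad dimension $\dim_A\mu\in[-\infty,\infty]$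 is the infimum of all real $d$ for which there are $C_1,C_2>0$ with $$\frac{\mu(B(x,R))}{\mu(B(x,r))}\le C_2\Big(\frac Rr\Big)^d\quad\text{for all }0<r<R\le C_1,\ R<1,\ x\in\operatorname{supp}\mu$$ (with $\inf\emptyset=\infty$), and the lower Assouad dimension $\dim_L\mu$ is the supremum of all real $d$ for which there are $C_1,C_2>0$ such that the same holds with $\ge$ in place of $\le$. Put $a_0=\operatorname{ess\,inf}a_1$, $b_0=\operatorname{ess\,inf}b_1$, $A_0=\operatorname{ess\,sup}a_1$, $B_0=\operatorname{ess\,sup}b_1$, $p_0=\operatorname{ess\,sup}p_1$, $q_0=\operatorname{ess\,sup}(1-p_1)$, $P_0=\operatorname{ess\,inf}p_1$, $Q_0=\operatorname{ess\,inf}(1-p_1)$, and $$\alpha=\max\Big(\frac{\log P_0}{\log A_0},\frac{\log Q_0}{\log B_0}\Big),\qquad \beta=\min\Big(\frac{\log p_0}{\log a_0},\frac{\log q_0}{\log b_0}\Big),$$ where $\alpha=\infty$ if $P_0=0$ or $Q_0=0$. Corollary. For $\mathcal P$-almost every $\omega$, $\dim_A\mu_\omega=\alpha$ and $\dim_L\mu_\omega=\beta$.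 -/

import Mathlib

open MeasureTheory ProbabilityTheory

noncomputable section

/-! ### Φ-dimensions and Assouad dimensions of measures -/

/-- The inequality `μ (B(x,R)) / μ (B(x,r)) ≤ C₂ (R/r)^d` holds for all `x` in the support of `μ`
and all `0 < r < R^(1+Φ(R)) ≤ R ≤ C₁`, for some constants `C₁, C₂ > 0`.
(The function `Φ` lives on `(0,1)`, hence `R < 1`; `μ` is a finite Borel measure.) -/
def IsUpperPhiBound {X : Type*} [MetricSpace X] [MeasurableSpace X]
    (Φ : ℝ → ℝ) (μ : Measure X) (d : ℝ) : Prop :=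
  ∃ C₁ > 0, ∃ C₂ > 0, ∀ r R : ℝ, 0 < r → r < R ^ (1 + Φ R) → R ^ (1 + Φ R) ≤ R → R ≤ C₁ → R < 1 →
    ∀ x ∈ μ.support, μ.real (Metric.ball x R) / μ.real (Metric.ball x r) ≤ C₂ * (R / r) ^ d

/-- As `IsUpperPhiBound`, with the inequality `μ (B(x,R)) / μ (B(x,r)) ≥ C₂ (R/r)^d`. -/
def IsLowerPhiBound {X : Type*} [MetricSpace X] [MeasurableSpace X]
    (Φ : ℝ → ℝ) (μ : Measure X) (d : ℝ) : Prop :=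
  ∃ C₁ > 0, ∃ C₂ > 0, ∀ r R : ℝ, 0 < r → r < R ^ (1 + Φ R) → R ^ (1 + Φ R) ≤ R → R ≤ C₁ → R < 1 →
    ∀ x ∈ μ.support, C₂ * (R / r) ^ d ≤ μ.real (Metric.ball x R) / μ.real (Metric.ball x r)

/-- Upper Φ-dimension of a measure (the infimum of the empty set is `∞`). -/
def upperPhiDim {X : Type*} [MetricSpace X] [MeasurableSpace X]
    (Φ : ℝ → ℝ) (μ : Measure X) : EReal :=
  sInf ((fun d : ℝ => (d : EReal)) '' {d : ℝ | IsUpperPhiBound Φ μ d})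

/-- Lower Φ-dimension of a measure. -/
def lowerPhiDim {X : Type*} [MetricSpace X] [MeasurableSpace X]
    (Φ : ℝ → ℝ) (μ : Measure X) : EReal :=
  sSup ((fun d : ℝ => (d : EReal)) '' {d : ℝ | IsLowerPhiBound Φ μ d})

/-- The (upper) Assouad dimension of a measure: the case `Φ = 0`. -/
def upperAssouadDim {X : Type*} [MetricSpace X] [MeasurableSpace X] (μ : Measure X) : EReal :=
  upperPhiDim (fun _ => 0) μ

/-- The lower Assouad dimension of a measure: the case `Φ = 0`. -/
def lowerAssouadDim {X : Type*} [MetricSpace X] [MeasurableSpace X] (μ : Measure X) : EReal :=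
  lowerPhiDim (fun _ => 0) μ

/-! ### Moran intervals and the Moran measure

Levels are indexed from `0`: the ratios `a n`, `b n` and the weights `p n`, `1 - p n` are used to
pass from step `n` to step `n + 1`. A Moran interval of step `n` is labelled by the first `n`
letters of a sequence `v : ℕ → Bool`, where `false` means left child and `true` right child. -/

/-- Length of the Moran interval of step `n` labelled by `v`. -/
def moranLength (a b : ℕ → ℝ) (v : ℕ → Bool) : ℕ → ℝ
  | 0 => 1
  | n + 1 => (if v n then b n else a n) * moranLength a b v n

/-- Left endpoint of the Moran interval of step `n` labelled by `v`: the left child keeps the left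
endpoint, the right child keeps the right endpoint. -/
def moranLeft (a b : ℕ → ℝ) (v : ℕ → Bool) : ℕ → ℝ
  | 0 => 0
  | n + 1 => moranLeft a b v n + if v n then (1 - b n) * moranLength a b v n else 0

/-- The Moran interval of step `n` labelled by the first `n` letters of `v`. -/
def moranInterval (a b : ℕ → ℝ) (v : ℕ → Bool) (n : ℕ) : Set ℝ :=
  Set.Icc (moranLeft a b v n) (moranLeft a b v n + moranLength a b v n)

/-- The point with address `v` of the Moran set: the common point of the nested intervals
`moranInterval a b v n`, `n : ℕ`, as the supremum of their left endpoints. -/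
def moranPoint (a b : ℕ → ℝ) (v : ℕ → Bool) : ℝ := ⨆ n, moranLeft a b v n

/-- The law on addresses: independent letters, the `n`-th one being left with probability `p n`
and right with probability `1 - p n`. -/
def addressMeasure (p : ℕ → unitInterval) : Measure (ℕ → Bool) :=
  Measure.infinitePi fun n => bernoulliMeasure false true (p n)

/-- The Moran measure: the image on the line of `addressMeasure p`. It is the Borel probability
measure determined by the rule that an interval of step `n` gives the fraction `p n` of its mass to
its left child and `1 - p n` to its right child; see `moranMeasure_left` and
`moranMeasure_right`. -/
def moranMeasure (a b : ℕ → ℝ) (p : ℕ → unitInterval) : Measure ℝ :=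
  (addressMeasure p).map (moranPoint a b)

/-- The admissible pairs of ratios, `{(x,y) ∈ [0,1]² : A ≤ min(x,y) < x + y ≤ B}`. -/
def ratioRegion (A B : ℝ) : Set (ℝ × ℝ) :=
  {z | z.1 ∈ Set.Icc 0 1 ∧ z.2 ∈ Set.Icc 0 1 ∧
    A ≤ min z.1 z.2 ∧ min z.1 z.2 < z.1 + z.2 ∧ z.1 + z.2 ≤ B}

/-! ### The almost sure values -/

/-- `max (log P₀ / log A₀, log Q₀ / log B₀)`, where `P₀ = ess inf p`, `Q₀ = ess inf (1 - p)`,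
`A₀ = ess sup a`, `B₀ = ess sup b`; it is `∞` if `P₀ = 0` or `Q₀ = 0`. -/
def moranAlpha {Ω : Type*} [MeasurableSpace Ω] (P : Measure Ω)
    (a b : Ω → ℝ) (p : Ω → unitInterval) : EReal :=
  let P₀ := essInf (fun ω => (p ω : ℝ)) P
  let Q₀ := essInf (fun ω => 1 - (p ω : ℝ)) P
  let A₀ := essSup a P
  let B₀ := essSup b P
  open Classical in
  if P₀ = 0 ∨ Q₀ = 0 then ⊤
  else ((max (Real.log P₀ / Real.log A₀) (Real.log Q₀ / Real.log B₀) : ℝ) : EReal)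

/-- `min (log p₀ / log a₀, log q₀ / log b₀)`, where `p₀ = ess sup p`, `q₀ = ess sup (1 - p)`,
`a₀ = ess inf a`, `b₀ = ess inf b`. -/
def moranBeta {Ω : Type*} [MeasurableSpace Ω] (P : Measure Ω)
    (a b : Ω → ℝ) (p : Ω → unitInterval) : ℝ :=
  let p₀ := essSup (fun ω => (p ω : ℝ)) P
  let q₀ := essSup (fun ω => 1 - (p ω : ℝ)) P
  let a₀ := essInf a P
  let b₀ := essInf b P
  min (Real.log p₀ / Real.log a₀) (Real.log q₀ / Real.log b₀)

/-! ### The measure satisfies its defining rule -/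

instance (p : ℕ → unitInterval) : IsProbabilityMeasure (addressMeasure p) := by
  unfold addressMeasure; infer_instance

theorem moranLength_congr (a b : ℕ → ℝ) {u v : ℕ → Bool} {n : ℕ} (h : ∀ i < n, u i = v i) :
    moranLength a b u n = moranLength a b v n := by
  induction n with
  | zero => rfl
  | succ n ih =>
    simp only [moranLength]
    rw [ih fun i hi => h i (by omega), h n (by omega)]

theorem moranLeft_congr (a b : ℕ → ℝ) {u v : ℕ → Bool} {n : ℕ} (h : ∀ i < n, u i = v i) :
    moranLeft a b u n = moranLeft a b v n := by
  induction n with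
  | zero => rfl
  | succ n ih =>
    simp only [moranLeft]
    rw [ih fun i hi => h i (by omega), h n (by omega),
      moranLength_congr a b fun i hi => h i (by omega)]

theorem measurable_moranPoint (a b : ℕ → ℝ) : Measurable (moranPoint a b) := by
  have hl : ∀ n, Measurable fun v : ℕ → Bool => moranLength a b v n := by
    intro n
    induction n with
    | zero => exact measurable_const
    | succ n ih =>
      simp only [moranLength]
      exact ((measurable_of_finite (fun c : Bool => if c then b n else a n)).comp
        (measurable_pi_apply n)).mul ih
  refine Measurable.iSup fun n => ?_
  induction n with
  | zero => exact measurable_const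
  | succ n ih =>
    simp only [moranLeft]
    refine ih.add (Measurable.ite ?_ ((hl n).const_mul _) measurable_const)
    exact (measurable_pi_apply (X := fun _ : ℕ => Bool) n) (measurableSet_singleton true)

instance (a b : ℕ → ℝ) (p : ℕ → unitInterval) : IsProbabilityMeasure (moranMeasure a b p) :=
  Measure.isProbabilityMeasure_map (measurable_moranPoint a b).aemeasurable

section Rule

variable {a b : ℕ → ℝ} {A B : ℝ}

theorem moranLength_pos (hA : 0 < A) (hab : ∀ n, (a n, b n) ∈ ratioRegion A B)
    (v : ℕ → Bool) (n : ℕ) : 0 < moranLength a b v n := by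
  induction n with
  | zero => exact one_pos
  | succ n ih =>
    have h := (hab n).2.2.1
    simp only [le_min_iff] at h
    simp only [moranLength]
    refine mul_pos ?_ ih
    split_ifs <;> linarith

theorem moranInterval_succ_subset (hA : 0 < A) (hB : B < 1)
    (hab : ∀ n, (a n, b n) ∈ ratioRegion A B) (v : ℕ → Bool) (n : ℕ) :
    moranLeft a b v n ≤ moranLeft a b v (n + 1) ∧
      moranLeft a b v (n + 1) + moranLength a b v (n + 1) ≤
        moranLeft a b v n + moranLength a b v n := by
  have hl := moranLength_pos hA hab v n
  obtain ⟨-, -, h, -, h'⟩ := hab n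
  simp only [le_min_iff] at h h'
  simp only [moranLeft, moranLength]
  cases v n
  · simp only [Bool.false_eq_true, if_false]
    constructor <;> nlinarith
  · simp only [if_true]
    constructor <;> nlinarith

theorem moranInterval_antitone (hA : 0 < A) (hB : B < 1)
    (hab : ∀ n, (a n, b n) ∈ ratioRegion A B) (v : ℕ → Bool) :
    Antitone (moranInterval a b v) :=
  antitone_nat_of_succ_le fun n =>
    Set.Icc_subset_Icc (moranInterval_succ_subset hA hB hab v n).1
      (moranInterval_succ_subset hA hB hab v n).2

theorem moranPoint_mem (hA : 0 < A) (hB : B < 1)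
    (hab : ∀ n, (a n, b n) ∈ ratioRegion A B) (v : ℕ → Bool) (n : ℕ) :
    moranPoint a b v ∈ moranInterval a b v n := by
  have hm : Monotone (moranLeft a b v) :=
    monotone_nat_of_le_succ fun n => (moranInterval_succ_subset hA hB hab v n).1
  have hup : ∀ m, moranLeft a b v m ≤ moranLeft a b v n + moranLength a b v n := by
    intro m
    have h1 : moranLeft a b v (max m n) ∈ moranInterval a b v (max m n) :=
      ⟨le_rfl, by linarith [moranLength_pos hA hab v (max m n)]⟩
    exact (hm (le_max_left m n)).trans
      (moranInterval_antitone hA hB hab v (le_max_right m n) h1).2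
  exact ⟨le_ciSup (f := moranLeft a b v) ⟨_, by rintro _ ⟨m, rfl⟩; exact hup m⟩ n, ciSup_le hup⟩

theorem moranPoint_mem_iff (hA : 0 < A) (hB : B < 1)
    (hab : ∀ n, (a n, b n) ∈ ratioRegion A B) (u v : ℕ → Bool) (n : ℕ) :
    moranPoint a b u ∈ moranInterval a b v n ↔ ∀ i < n, u i = v i := by
  refine ⟨fun h => ?_, fun h => ?_⟩
  · induction n with
    | zero => intro i hi; omega
    | succ n ih =>
      have hn := ih (moranInterval_antitone hA hB hab v (Nat.le_succ n) h)
      intro i hi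
      rcases Nat.lt_succ_iff_lt_or_eq.mp hi with hi | rfl
      · exact hn i hi
      have hu := moranPoint_mem hA hB hab u (i + 1)
      have hl := moranLength_pos hA hab v i
      obtain ⟨-, -, h3, -, h4⟩ := hab i
      simp only [le_min_iff] at h3 h4
      simp only [moranInterval, moranLeft, moranLength, Set.mem_Icc, moranLeft_congr a b hn,
        moranLength_congr a b hn] at h hu
      by_contra hne
      cases hui : u i <;> cases hvi : v i <;> simp [hui, hvi] at h hu hne <;> nlinarith
  · have := moranPoint_mem hA hB hab u n
    rwa [moranInterval, moranLeft_congr a b h, moranLength_congr a b h] at this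

/-- The mass of a Moran interval is the product of the weights along its label. -/
theorem moranMeasure_interval (hA : 0 < A) (hB : B < 1)
    (hab : ∀ n, (a n, b n) ∈ ratioRegion A B) (p : ℕ → unitInterval) (v : ℕ → Bool) (n : ℕ) :
    (moranMeasure a b p).real (moranInterval a b v n) =
      ∏ i ∈ Finset.range n, if v i then 1 - (p i : ℝ) else (p i : ℝ) := by
  have hpre : moranPoint a b ⁻¹' moranInterval a b v n =
      Set.pi (Finset.range n : Set ℕ) fun i => {v i} := by
    ext u
    simp [moranPoint_mem_iff hA hB hab, Set.mem_pi]
  have hI : MeasurableSet (moranInterval a b v n) := measurableSet_Icc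
  rw [measureReal_def, moranMeasure, Measure.map_apply (measurable_moranPoint a b) hI, hpre, addressMeasure, Measure.infinitePi_pi _ fun i _ =>
    measurableSet_singleton _, ENNReal.toReal_prod]
  refine Finset.prod_congr rfl fun i _ => ?_
  rw [← measureReal_def, bernoulliMeasure_real_apply _ (measurableSet_singleton _)]
  cases v i <;> simp

theorem moranMeasure_left (hA : 0 < A) (hB : B < 1)
    (hab : ∀ n, (a n, b n) ∈ ratioRegion A B) (p : ℕ → unitInterval) (v : ℕ → Bool) (n : ℕ)
    (hv : v n = false) :
    (moranMeasure a b p).real (moranInterval a b v (n + 1)) =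
      p n * (moranMeasure a b p).real (moranInterval a b v n) := by
  rw [moranMeasure_interval hA hB hab, moranMeasure_interval hA hB hab, Finset.prod_range_succ, hv]
  simp [mul_comm]

theorem moranMeasure_right (hA : 0 < A) (hB : B < 1)
    (hab : ∀ n, (a n, b n) ∈ ratioRegion A B) (p : ℕ → unitInterval) (v : ℕ → Bool) (n : ℕ)
    (hv : v n = true) :
    (moranMeasure a b p).real (moranInterval a b v (n + 1)) =
      (1 - p n) * (moranMeasure a b p).real (moranInterval a b v n) := by
  rw [moranMeasure_interval hA hB hab, moranMeasure_interval hA hB hab, Finset.prod_range_succ, hv]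
  simp [mul_comm]

end Rule

end

/-!
Sibling Moran intervals of step `n + 1` are separated by a gap of at least `(1 - B)` times the
length of their parent. Hence the ball of radius `r` about a point of the limit set is sandwiched
between Moran intervals about that point of length comparable to `r`, and a quotient of measures of
concentric balls is bounded by products of inverse weights over a block of steps, to be compared
with the product of inverse ratios over the same block. So `d` is an upper bound as soon as
`ratio ^ d ≤ weight` for each child in every step, a lower bound as soon as `weight ≤ ratio ^ d`.

For the converse, ratio and weight of the same child are independent, so in each step they are
simultaneously near prescribed essential extremes with positive probability. By the second
Borel–Cantelli lemma on disjoint blocks, almost surely this happens in arbitrarily long runs of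
consecutive steps. Along a constant label such a run forces a bound `d` to satisfy the inequality at
these extremes.
-/

open Filter Topology

section PowersAndProducts

theorem le_of_forall_pow_le_mul_pow {x y C : ℝ} {K : ℕ} (hy : 0 ≤ y)
    (h : ∀ k ≥ K, x ^ k ≤ C * y ^ k) : x ≤ y := by
  by_contra! hyx
  have hx : 0 < x := hy.trans_lt hyx
  have hlim : Tendsto (fun k : ℕ => C * (y / x) ^ k) atTop (𝓝 0) := by
    simpa using (tendsto_pow_atTop_nhds_zero_of_lt_one (div_nonneg hy hx.le)
      ((div_lt_one hx).2 hyx)).const_mul C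
  refine (one_pos (α := ℝ)).not_ge (ge_of_tendsto hlim ?_)
  filter_upwards [eventually_ge_atTop K] with k hk
  rw [div_pow, ← mul_div_assoc, one_le_div (pow_pos hx k)]
  exact h k hk

theorem prod_range_div_prod_range {F : Type*} [Field F] {f : ℕ → F} (hf : ∀ i, f i ≠ 0)
    {m n : ℕ} (hmn : m ≤ n) :
    (∏ i ∈ Finset.range m, f i) / ∏ i ∈ Finset.range n, f i = ∏ i ∈ Finset.Ico m n, (f i)⁻¹ := by
  rw [← Finset.prod_range_mul_prod_Ico f hmn,
    div_mul_cancel_left₀ (Finset.prod_ne_zero_iff.2 fun i _ => hf i), Finset.prod_inv_distrib]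

theorem pow_le_prod_Ico_add {f : ℕ → ℝ} {s : ℝ} {n k : ℕ} (hs : 0 ≤ s)
    (h : ∀ i ∈ Set.Ico n (n + k), s ≤ f i) : s ^ k ≤ ∏ i ∈ Finset.Ico n (n + k), f i := by
  simpa using Finset.prod_le_prod (s := Finset.Ico n (n + k)) (fun _ _ => hs)
    fun i hi => h i (Finset.mem_Ico.1 hi)

theorem prod_Ico_add_le_pow {f : ℕ → ℝ} {t : ℝ} {n k : ℕ} (hf : ∀ i, 0 ≤ f i)
    (h : ∀ i ∈ Set.Ico n (n + k), f i ≤ t) : ∏ i ∈ Finset.Ico n (n + k), f i ≤ t ^ k := by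
  simpa using Finset.prod_le_prod (s := Finset.Ico n (n + k)) (fun i _ => hf i)
    fun i hi => h i (Finset.mem_Ico.1 hi)

end PowersAndProducts

/-- A set of natural numbers is thick if it contains intervals of every length. It then contains
intervals of every length beyond every index, see `IsThick.exists_ge`. -/
def IsThick (S : Set ℕ) : Prop := ∀ k, ∃ n, Set.Ico n (n + k) ⊆ S

theorem IsThick.mono {S T : Set ℕ} (hS : IsThick S) (hST : S ⊆ T) : IsThick T := fun k =>
  (hS k).imp fun _ hn => hn.trans hST

theorem IsThick.exists_ge {S : Set ℕ} (hS : IsThick S) (k N : ℕ) :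
    ∃ n ≥ N, Set.Ico n (n + k) ⊆ S := by
  obtain ⟨n, hn⟩ := hS (N + k)
  refine ⟨n + N, Nat.le_add_left N n, fun i hi => hn ?_⟩
  exact ⟨(Nat.le_add_right n N).trans hi.1, add_assoc n N k ▸ hi.2⟩

theorem IsThick.nonempty {S : Set ℕ} (hS : IsThick S) : S.Nonempty :=
  (hS 1).imp fun n hn => hn ⟨le_rfl, n.lt_succ_self⟩

section PhiDimension

variable {X : Type*} [MetricSpace X] [MeasurableSpace X] {Φ : ℝ → ℝ} {μ : Measure X}

theorem isUpperPhiBound_zero_iff {d : ℝ} :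
    IsUpperPhiBound (fun _ => 0) μ d ↔ ∃ C₁ > 0, ∃ C₂ > 0, ∀ r R : ℝ, 0 < r → r < R → R ≤ C₁ →
      R < 1 → ∀ x ∈ μ.support,
        μ.real (Metric.ball x R) / μ.real (Metric.ball x r) ≤ C₂ * (R / r) ^ d := by
  simp [IsUpperPhiBound]

theorem isLowerPhiBound_zero_iff {d : ℝ} :
    IsLowerPhiBound (fun _ => 0) μ d ↔ ∃ C₁ > 0, ∃ C₂ > 0, ∀ r R : ℝ, 0 < r → r < R → R ≤ C₁ →
      R < 1 → ∀ x ∈ μ.support,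
        C₂ * (R / r) ^ d ≤ μ.real (Metric.ball x R) / μ.real (Metric.ball x r) := by
  simp [IsLowerPhiBound]

theorem IsUpperPhiBound.mono {d d' : ℝ} (h : IsUpperPhiBound Φ μ d) (hd : d ≤ d') :
    IsUpperPhiBound Φ μ d' := by
  obtain ⟨C₁, hC₁, C₂, hC₂, h⟩ := h
  refine ⟨C₁, hC₁, C₂, hC₂, fun r R hr hrR hRR hRC hR1 x hx =>
    (h r R hr hrR hRR hRC hR1 x hx).trans ?_⟩
  have hone : 1 ≤ R / r := (one_le_div hr).2 (hrR.le.trans hRR)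
  gcongr

theorem upperPhiDim_eq_coe {α : ℝ} (hα : 0 < α)
    (h : ∀ d, 0 ≤ d → (IsUpperPhiBound Φ μ d ↔ α ≤ d)) : upperPhiDim Φ μ = α := by
  refine le_antisymm (sInf_le ⟨α, (h α hα.le).2 le_rfl, rfl⟩) (le_sInf ?_)
  rintro _ ⟨d, hd, rfl⟩
  have hmax : α ≤ max d 0 := (h _ (le_max_right d 0)).1 (hd.mono (le_max_left d 0))
  exact EReal.coe_le_coe ((le_max_iff.1 hmax).resolve_right hα.not_ge)

theorem upperPhiDim_eq_top (h : ∀ d, 0 ≤ d → ¬IsUpperPhiBound Φ μ d) : upperPhiDim Φ μ = ⊤ := by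
  refine top_unique (le_sInf ?_)
  rintro _ ⟨d, hd, rfl⟩
  exact absurd (hd.mono (le_max_left d 0)) (h _ (le_max_right d 0))

theorem lowerPhiDim_eq_coe {β : ℝ} (hβ : 0 ≤ β)
    (h : ∀ d, 0 ≤ d → (IsLowerPhiBound Φ μ d ↔ d ≤ β)) : lowerPhiDim Φ μ = β := by
  refine le_antisymm (sSup_le ?_) (le_sSup ⟨β, (h β hβ).2 le_rfl, rfl⟩)
  rintro _ ⟨d, hd, rfl⟩
  exact EReal.coe_le_coe ((le_total d 0).elim hβ.trans' fun hd0 => (h d hd0).1 hd)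

end PhiDimension

/-- The ratio of a child interval to its parent, read off the pair `z` of ratios of the step; as in
labels, `false` is the left child and `true` the right one. -/
noncomputable def childRatio (c : Bool) (z : ℝ × ℝ) : ℝ := if c then z.2 else z.1

/-- The fraction of the mass of an interval carried by its child `c`, if `q` is the fraction carried
by the left child. -/
noncomputable def childWeight (c : Bool) (q : unitInterval) : ℝ := if c then 1 - (q : ℝ) else q

theorem measurable_childRatio (c : Bool) : Measurable (childRatio c) := by
  cases c
  exacts [measurable_fst, measurable_snd]

theorem measurable_childWeight (c : Bool) : Measurable (childWeight c) := by
  cases c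
  exacts [measurable_subtype_coe, measurable_subtype_coe.const_sub 1]

theorem childRatio_mem_Icc {A B : ℝ} {z : ℝ × ℝ} (hz : z ∈ ratioRegion A B) (c : Bool) :
    childRatio c z ∈ Set.Icc A B := by
  obtain ⟨⟨h₁, -⟩, ⟨h₂, -⟩, hA, -, hB⟩ := hz
  rw [le_min_iff] at hA
  cases c
  exacts [⟨hA.1, (le_add_of_nonneg_right h₂).trans hB⟩, ⟨hA.2, (le_add_of_nonneg_left h₁).trans hB⟩]

theorem childRatio_pos {A B : ℝ} (hA : 0 < A) {z : ℝ × ℝ} (hz : z ∈ ratioRegion A B) (c : Bool) :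
    0 < childRatio c z :=
  hA.trans_le (childRatio_mem_Icc hz c).1

theorem ratioRegion_bound_pos {A B : ℝ} (hA : 0 < A) {z : ℝ × ℝ} (hz : z ∈ ratioRegion A B) :
    0 < B :=
  (childRatio_pos hA hz false).trans_le (childRatio_mem_Icc hz false).2

theorem childWeight_mem_Icc (c : Bool) (q : unitInterval) : childWeight c q ∈ Set.Icc 0 1 := by
  cases c
  exacts [q.2, ⟨unitInterval.one_minus_nonneg q, unitInterval.one_minus_le_one q⟩]

theorem childWeight_pos {q : unitInterval} (hq : q ∈ Set.Ioo 0 1) (c : Bool) :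
    0 < childWeight c q := by
  cases c
  exacts [hq.1, sub_pos.2 hq.2]

theorem childWeight_lt_one {q : unitInterval} (hq : q ∈ Set.Ioo 0 1) (c : Bool) :
    childWeight c q < 1 := by
  cases c
  exacts [hq.2, sub_lt_self 1 hq.1]

/-- The mass of the Moran interval of step `n` labelled by `v`. -/
noncomputable def moranMass (p : ℕ → unitInterval) (v : ℕ → Bool) (n : ℕ) : ℝ :=
  ∏ i ∈ Finset.range n, childWeight (v i) (p i)

theorem moranLength_succ (a b : ℕ → ℝ) (v : ℕ → Bool) (n : ℕ) :
    moranLength a b v (n + 1) = childRatio (v n) (a n, b n) * moranLength a b v n := rfl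

theorem moranLength_eq_prod (a b : ℕ → ℝ) (v : ℕ → Bool) (n : ℕ) :
    moranLength a b v n = ∏ i ∈ Finset.range n, childRatio (v i) (a i, b i) := by
  induction n with
  | zero => rfl
  | succ n ih => rw [moranLength_succ, Finset.prod_range_succ, ih, mul_comm]

section Mass

variable {p : ℕ → unitInterval}

theorem moranMass_pos (hp : ∀ n, p n ∈ Set.Ioo 0 1) (v : ℕ → Bool) (n : ℕ) :
    0 < moranMass p v n :=
  Finset.prod_pos fun i _ => childWeight_pos (hp i) (v i)

theorem moranMass_antitone (p : ℕ → unitInterval) (v : ℕ → Bool) : Antitone (moranMass p v) :=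
  antitone_nat_of_succ_le fun n => by
    rw [moranMass, Finset.prod_range_succ]
    exact mul_le_of_le_one_right (Finset.prod_nonneg fun i _ => (childWeight_mem_Icc _ _).1)
      (childWeight_mem_Icc _ _).2

theorem moranMass_div (hp : ∀ n, p n ∈ Set.Ioo 0 1) (v : ℕ → Bool) {m n : ℕ} (hmn : m ≤ n) :
    moranMass p v m / moranMass p v n = ∏ i ∈ Finset.Ico m n, (childWeight (v i) (p i))⁻¹ :=
  prod_range_div_prod_range (fun i => (childWeight_pos (hp i) (v i)).ne') hmn

end Mass

section Length

variable {a b : ℕ → ℝ} {A B : ℝ}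

theorem moranLength_div (hA : 0 < A) (hab : ∀ n, (a n, b n) ∈ ratioRegion A B) (v : ℕ → Bool)
    {m n : ℕ} (hmn : m ≤ n) :
    moranLength a b v m / moranLength a b v n =
      ∏ i ∈ Finset.Ico m n, (childRatio (v i) (a i, b i))⁻¹ := by
  simp only [moranLength_eq_prod]
  exact prod_range_div_prod_range (fun i => (childRatio_pos hA (hab i) (v i)).ne') hmn

theorem moranLength_antitone (hA : 0 < A) (hB : B < 1) (hab : ∀ n, (a n, b n) ∈ ratioRegion A B)
    (v : ℕ → Bool) : Antitone (moranLength a b v) :=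
  antitone_nat_of_succ_le fun n => mul_le_of_le_one_left (moranLength_pos hA hab v n).le
    ((childRatio_mem_Icc (hab n) (v n)).2.trans hB.le)

theorem mul_moranLength_le (hA : 0 < A) (hab : ∀ n, (a n, b n) ∈ ratioRegion A B) (v : ℕ → Bool)
    (n : ℕ) : A * moranLength a b v n ≤ moranLength a b v (n + 1) :=
  mul_le_mul_of_nonneg_right (childRatio_mem_Icc (hab n) (v n)).1 (moranLength_pos hA hab v n).le

theorem moranLength_add_le (hA : 0 < A) (hab : ∀ n, (a n, b n) ∈ ratioRegion A B) (v : ℕ → Bool)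
    (n k : ℕ) : moranLength a b v (n + k) ≤ B ^ k * moranLength a b v n := by
  rw [moranLength_eq_prod, moranLength_eq_prod, mul_comm,
    ← Finset.prod_range_mul_prod_Ico _ (Nat.le_add_right n k)]
  refine mul_le_mul_of_nonneg_left (prod_Ico_add_le_pow (fun i => (childRatio_pos hA (hab i) _).le)
    fun i _ => (childRatio_mem_Icc (hab i) _).2) ?_
  exact Finset.prod_nonneg fun i _ => (childRatio_pos hA (hab i) _).le

theorem moranLength_le_pow (hA : 0 < A) (hab : ∀ n, (a n, b n) ∈ ratioRegion A B) (v : ℕ → Bool)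
    (n : ℕ) : moranLength a b v n ≤ B ^ n := by
  simpa [moranLength] using moranLength_add_le hA hab v 0 n

theorem exists_moranLength_lt (hA : 0 < A) (hB : B < 1) (hab : ∀ n, (a n, b n) ∈ ratioRegion A B)
    {r : ℝ} (hr : 0 < r) : ∃ N, ∀ v, ∀ n ≥ N, moranLength a b v n < r := by
  obtain ⟨N, hN⟩ := exists_pow_lt_of_lt_one hr hB
  exact ⟨N, fun v n hn => (moranLength_antitone hA hB hab v hn).trans_lt
    ((moranLength_le_pow hA hab v N).trans_lt hN)⟩

theorem exists_moranLength_succ_lt_le (hA : 0 < A) (hB : B < 1)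
    (hab : ∀ n, (a n, b n) ∈ ratioRegion A B) (v : ℕ → Bool) {r : ℝ} (hr : 0 < r) (hr1 : r ≤ 1) :
    ∃ n, moranLength a b v (n + 1) < r ∧ r ≤ moranLength a b v n := by
  by_contra! h
  have hle : ∀ n, r ≤ moranLength a b v n := fun n =>
    Nat.rec hr1 (fun n ih => not_lt.1 fun hlt => (h n hlt).not_ge ih) n
  obtain ⟨N, hN⟩ := exists_moranLength_lt hA hB hab hr
  exact (hN v N le_rfl).not_ge (hle N)

end Length

section Balls

variable {a b : ℕ → ℝ} {A B : ℝ} {p : ℕ → unitInterval} {v : ℕ → Bool}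

theorem moranInterval_subset_closedBall (hA : 0 < A) (hB : B < 1)
    (hab : ∀ n, (a n, b n) ∈ ratioRegion A B) (v : ℕ → Bool) (n : ℕ) :
    moranInterval a b v n ⊆ Metric.closedBall (moranPoint a b v) (moranLength a b v n) :=
  fun x hx => by
    simpa [Metric.mem_closedBall] using Real.dist_le_of_mem_Icc hx (moranPoint_mem hA hB hab v n)

theorem le_dist_moranPoint (hA : 0 < A) (hB : B < 1) (hab : ∀ n, (a n, b n) ∈ ratioRegion A B)
    {u v : ℕ → Bool} {n : ℕ} (h : ∀ i < n, u i = v i) (hne : u n ≠ v n) :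
    (1 - B) * moranLength a b v n ≤ dist (moranPoint a b u) (moranPoint a b v) := by
  wlog huv : u n = false ∧ v n = true generalizing u v
  · rw [dist_comm, ← moranLength_congr a b h]
    exact this (fun i hi => (h i hi).symm) hne.symm (by grind)
  have hu := (moranPoint_mem hA hB hab u (n + 1)).2
  have hv := (moranPoint_mem hA hB hab v (n + 1)).1
  have hgap := mul_le_mul_of_nonneg_right (hab n).2.2.2.2 (moranLength_pos hA hab v n).le
  simp only [moranLeft, moranLength, huv, moranLeft_congr a b h, moranLength_congr a b h,
    Bool.false_eq_true, if_false, if_true] at hu hv hgap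
  rw [dist_comm, Real.dist_eq]
  refine le_trans ?_ (le_abs_self _)
  linarith

theorem moranMass_le_measureReal_ball (hA : 0 < A) (hB : B < 1)
    (hab : ∀ n, (a n, b n) ∈ ratioRegion A B) {n : ℕ} {r : ℝ} (hr : moranLength a b v n < r) :
    moranMass p v n ≤ (moranMeasure a b p).real (Metric.ball (moranPoint a b v) r) :=
  (moranMeasure_interval hA hB hab p v n).symm.trans_le <| measureReal_mono <|
    (moranInterval_subset_closedBall hA hB hab v n).trans (Metric.closedBall_subset_ball hr)

theorem measureReal_ball_le_moranMass_succ (hA : 0 < A) (hB : B < 1)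
    (hab : ∀ n, (a n, b n) ∈ ratioRegion A B) {n : ℕ} {r : ℝ}
    (hr : r ≤ (1 - B) * moranLength a b v n) :
    (moranMeasure a b p).real (Metric.ball (moranPoint a b v) r) ≤ moranMass p v (n + 1) := by
  refine le_of_le_of_eq ?_ (moranMeasure_interval hA hB hab p v (n + 1))
  have hmeas := measurable_moranPoint a b
  have hI : MeasurableSet (moranInterval a b v (n + 1)) := measurableSet_Icc
  rw [moranMeasure, map_measureReal_apply hmeas measurableSet_ball, map_measureReal_apply hmeas hI]
  refine measureReal_mono fun u hu => (moranPoint_mem_iff hA hB hab u v (n + 1)).2 ?_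
  rcases eq_or_ne u v with rfl | hne
  · exact fun _ _ => rfl
  suffices n < PiNat.firstDiff u v from fun i hi => PiNat.apply_eq_of_lt_firstDiff (by omega)
  by_contra! hle
  refine (Metric.mem_ball.1 hu).not_ge (hr.trans ?_)
  have hlen := moranLength_antitone hA hB hab v hle
  exact (mul_le_mul_of_nonneg_left hlen (sub_nonneg.2 hB.le)).trans <|
    le_dist_moranPoint hA hB hab (fun i hi => PiNat.apply_eq_of_lt_firstDiff hi)
      (PiNat.apply_firstDiff_ne hne)

theorem continuous_moranPoint (hA : 0 < A) (hB : B < 1)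
    (hab : ∀ n, (a n, b n) ∈ ratioRegion A B) : Continuous (moranPoint a b) := by
  refine Metric.continuous_iff'.2 fun v ε hε => ?_
  obtain ⟨n, hn⟩ := exists_moranLength_lt hA hB hab hε
  filter_upwards [(PiNat.isOpen_cylinder (fun _ => Bool) v n).mem_nhds
    (PiNat.self_mem_cylinder v n)] with u hu
  have hmem := (moranPoint_mem_iff hA hB hab u v n).2 (PiNat.mem_cylinder_iff.1 hu)
  exact (moranInterval_subset_closedBall hA hB hab v n hmem).trans_lt (hn v n le_rfl)

theorem measureReal_ball_moranPoint_pos (hA : 0 < A) (hB : B < 1)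
    (hab : ∀ n, (a n, b n) ∈ ratioRegion A B) (hp : ∀ n, p n ∈ Set.Ioo 0 1) (v : ℕ → Bool)
    {r : ℝ} (hr : 0 < r) :
    0 < (moranMeasure a b p).real (Metric.ball (moranPoint a b v) r) := by
  obtain ⟨n, hn⟩ := exists_moranLength_lt hA hB hab hr
  exact (moranMass_pos hp v n).trans_le (moranMass_le_measureReal_ball hA hB hab (hn v n le_rfl))

theorem support_moranMeasure (hA : 0 < A) (hB : B < 1) (hab : ∀ n, (a n, b n) ∈ ratioRegion A B)
    (hp : ∀ n, p n ∈ Set.Ioo 0 1) :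
    (moranMeasure a b p).support = Set.range (moranPoint a b) := by
  have hclosed := (isCompact_range (continuous_moranPoint hA hB hab)).isClosed
  refine (Measure.support_subset_of_isClosed hclosed ?_).antisymm ?_
  · exact (ae_map_iff (measurable_moranPoint a b).aemeasurable hclosed.measurableSet).2
      (Eventually.of_forall Set.mem_range_self)
  · rintro _ ⟨v, rfl⟩
    exact Metric.nhds_basis_ball.mem_measureSupport.2 fun r hr =>
      (ENNReal.toReal_pos_iff.1 (measureReal_ball_moranPoint_pos hA hB hab hp v hr)).1

end Balls

section SymbolicBounds

variable {a b : ℕ → ℝ} {A B : ℝ} {p : ℕ → unitInterval} {d : ℝ}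

theorem exists_measureReal_ball_div_le (hA : 0 < A) (hB : B < 1)
    (hab : ∀ n, (a n, b n) ∈ ratioRegion A B) (hp : ∀ n, p n ∈ Set.Ioo 0 1) (v : ℕ → Bool)
    {r R : ℝ} (hr : 0 < r) (hrR : r < R) (hR : R ≤ 1 - B) :
    ∃ m n, m ≤ n ∧
      (moranMeasure a b p).real (Metric.ball (moranPoint a b v) R) /
        (moranMeasure a b p).real (Metric.ball (moranPoint a b v) r) ≤
          moranMass p v m / moranMass p v n ∧
      moranLength a b v m / moranLength a b v n ≤ ((1 - B) * A)⁻¹ * (R / r) := by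
  have hB' : 0 < 1 - B := sub_pos.2 hB
  have hR0 : 0 < R := hr.trans hrR
  have hr1 : r ≤ 1 := (hrR.le.trans hR).trans (sub_le_self 1 (ratioRegion_bound_pos hA (hab 0)).le)
  obtain ⟨m, hm, hm'⟩ := exists_moranLength_succ_lt_le hA hB hab v (div_pos hR0 hB')
    ((div_le_one hB').2 hR)
  obtain ⟨n, hn, hn'⟩ := exists_moranLength_succ_lt_le hA hB hab v hr hr1
  rw [div_le_iff₀' hB'] at hm'
  refine ⟨m + 1, n + 1, ?_, ?_, ?_⟩
  · by_contra! hnm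
    have := moranLength_antitone hA hB hab v (Nat.le_of_lt_succ hnm)
    nlinarith [moranLength_pos hA hab v m, ratioRegion_bound_pos hA (hab 0)]
  · exact div_le_div₀ (moranMass_pos hp v _).le (measureReal_ball_le_moranMass_succ hA hB hab hm')
      (moranMass_pos hp v _) (moranMass_le_measureReal_ball hA hB hab hn)
  · calc moranLength a b v (m + 1) / moranLength a b v (n + 1)
        ≤ (R / (1 - B)) / (A * r) := div_le_div₀ (by positivity) hm.le (by positivity)
          ((mul_le_mul_of_nonneg_left hn' hA.le).trans (mul_moranLength_le hA hab v n))
      _ = ((1 - B) * A)⁻¹ * (R / r) := by field_simp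

theorem exists_le_measureReal_ball_div (hA : 0 < A) (hB : B < 1)
    (hab : ∀ n, (a n, b n) ∈ ratioRegion A B) (hp : ∀ n, p n ∈ Set.Ioo 0 1) (v : ℕ → Bool)
    {r R : ℝ} (hr : 0 < r) (hrR : r < R) (hR : R ≤ 1 - B) :
    ∃ m n, m ≤ n ∧
      moranMass p v m / moranMass p v n ≤
        (moranMeasure a b p).real (Metric.ball (moranPoint a b v) R) /
          (moranMeasure a b p).real (Metric.ball (moranPoint a b v) r) ∧
      (1 - B) * A * (R / r) ≤ moranLength a b v m / moranLength a b v n := by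
  have hB' : 0 < 1 - B := sub_pos.2 hB
  have hR0 : 0 < R := hr.trans hrR
  have hR1 : R ≤ 1 := hR.trans (sub_le_self 1 (ratioRegion_bound_pos hA (hab 0)).le)
  obtain ⟨m, hm, hm'⟩ := exists_moranLength_succ_lt_le hA hB hab v hR0 hR1
  obtain ⟨n, hn, hn'⟩ := exists_moranLength_succ_lt_le hA hB hab v (div_pos hr hB')
    ((div_le_one hB').2 (hrR.le.trans hR))
  have hball := measureReal_ball_moranPoint_pos hA hB hab hp v hr
  have hlen : (1 - B) * A * (R / r) ≤ moranLength a b v (m + 1) / moranLength a b v (n + 1) :=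
    calc (1 - B) * A * (R / r) = A * R / (r / (1 - B)) := by field_simp
      _ ≤ _ := div_le_div₀ (moranLength_pos hA hab v _).le
        ((mul_le_mul_of_nonneg_left hm' hA.le).trans (mul_moranLength_le hA hab v m))
        (moranLength_pos hA hab v _) hn.le
  rcases le_total m n with hmn | hnm
  · rw [div_le_iff₀' hB'] at hn'
    exact ⟨m + 1, n + 1, Nat.succ_le_succ hmn,
      div_le_div₀ measureReal_nonneg (moranMass_le_measureReal_ball hA hB hab hm) hball
        (measureReal_ball_le_moranMass_succ hA hB hab hn'), hlen⟩
  · -- The two radii are then comparable, and the empty quotient `m = n` does.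
    refine ⟨m, m, le_rfl, ?_, hlen.trans ?_⟩
    · rw [div_self (moranMass_pos hp v m).ne', one_le_div hball]
      exact measureReal_mono (Metric.ball_subset_ball hrR.le)
    · rw [div_self (moranLength_pos hA hab v m).ne', div_le_one (moranLength_pos hA hab v _)]
      exact moranLength_antitone hA hB hab v (Nat.succ_le_succ hnm)

theorem isUpperPhiBound_of_moranMass_div_le (hA : 0 < A) (hB : B < 1)
    (hab : ∀ n, (a n, b n) ∈ ratioRegion A B) (hp : ∀ n, p n ∈ Set.Ioo 0 1) (hd : 0 ≤ d)
    (h : ∀ v m n, m ≤ n → moranMass p v m / moranMass p v n ≤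
      (moranLength a b v m / moranLength a b v n) ^ d) :
    IsUpperPhiBound (fun _ => 0) (moranMeasure a b p) d := by
  have hB' : 0 < 1 - B := sub_pos.2 hB
  refine isUpperPhiBound_zero_iff.2 ⟨1 - B, hB', ((1 - B) * A)⁻¹ ^ d, by positivity, ?_⟩
  intro r R hr hrR hR _ x hx
  obtain ⟨v, rfl⟩ := (support_moranMeasure hA hB hab hp).le hx
  obtain ⟨m, n, hmn, hmass, hlen⟩ := exists_measureReal_ball_div_le hA hB hab hp v hr hrR hR
  have hm := moranLength_pos hA hab v m
  have hn := moranLength_pos hA hab v n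
  have hR0 := hr.trans hrR
  calc _ ≤ moranMass p v m / moranMass p v n := hmass
    _ ≤ (moranLength a b v m / moranLength a b v n) ^ d := h v m n hmn
    _ ≤ (((1 - B) * A)⁻¹ * (R / r)) ^ d := Real.rpow_le_rpow (by positivity) hlen hd
    _ = ((1 - B) * A)⁻¹ ^ d * (R / r) ^ d := Real.mul_rpow (by positivity) (by positivity)

theorem isLowerPhiBound_of_le_moranMass_div (hA : 0 < A) (hB : B < 1)
    (hab : ∀ n, (a n, b n) ∈ ratioRegion A B) (hp : ∀ n, p n ∈ Set.Ioo 0 1) (hd : 0 ≤ d)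
    (h : ∀ v m n, m ≤ n → (moranLength a b v m / moranLength a b v n) ^ d ≤
      moranMass p v m / moranMass p v n) :
    IsLowerPhiBound (fun _ => 0) (moranMeasure a b p) d := by
  have hB' : 0 < 1 - B := sub_pos.2 hB
  refine isLowerPhiBound_zero_iff.2 ⟨1 - B, hB', ((1 - B) * A) ^ d, by positivity, ?_⟩
  intro r R hr hrR hR _ x hx
  obtain ⟨v, rfl⟩ := (support_moranMeasure hA hB hab hp).le hx
  obtain ⟨m, n, hmn, hmass, hlen⟩ := exists_le_measureReal_ball_div hA hB hab hp v hr hrR hR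
  have hR0 := hr.trans hrR
  calc ((1 - B) * A) ^ d * (R / r) ^ d = ((1 - B) * A * (R / r)) ^ d :=
        (Real.mul_rpow (by positivity) (by positivity)).symm
    _ ≤ (moranLength a b v m / moranLength a b v n) ^ d := by gcongr
    _ ≤ moranMass p v m / moranMass p v n := h v m n hmn
    _ ≤ _ := hmass

theorem IsUpperPhiBound.exists_moranMass_div_le (hA : 0 < A) (hB : B < 1)
    (hab : ∀ n, (a n, b n) ∈ ratioRegion A B) (hp : ∀ n, p n ∈ Set.Ioo 0 1)
    (h : IsUpperPhiBound (fun _ => 0) (moranMeasure a b p) d) :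
    ∃ C > 0, ∃ N, ∀ v m n, N ≤ m → m ≤ n → moranMass p v m / moranMass p v n ≤
      C * (moranLength a b v m / moranLength a b v n) ^ d := by
  obtain ⟨C₁, hC₁, C₂, hC₂, h⟩ := isUpperPhiBound_zero_iff.1 h
  have hB' : 0 < 1 - B := sub_pos.2 hB
  obtain ⟨N, hN⟩ := exists_moranLength_lt hA hB hab (half_pos (lt_min hC₁ one_pos))
  refine ⟨C₂ * (2 / (1 - B)) ^ d, by positivity, N, fun v m n hm hmn => ?_⟩
  have hlm := moranLength_pos hA hab v m
  have hln := moranLength_pos hA hab v n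
  have hsmall : 2 * moranLength a b v m < min C₁ 1 := by linarith [hN v m hm]
  have hrR : (1 - B) * moranLength a b v n < 2 * moranLength a b v m := by
    nlinarith [moranLength_antitone hA hB hab v hmn, ratioRegion_bound_pos hA (hab 0)]
  have hball := h _ _ (by positivity) hrR (hsmall.le.trans (min_le_left _ _))
    (hsmall.trans_le (min_le_right _ _)) _ ((support_moranMeasure hA hB hab hp).ge ⟨v, rfl⟩)
  calc moranMass p v m / moranMass p v n
      ≤ _ := div_le_div₀ measureReal_nonneg
        (moranMass_le_measureReal_ball hA hB hab (lt_mul_of_one_lt_left hlm one_lt_two))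
        (measureReal_ball_moranPoint_pos hA hB hab hp v (mul_pos hB' hln))
        ((measureReal_ball_le_moranMass_succ hA hB hab le_rfl).trans
          (moranMass_antitone p v n.le_succ))
    _ ≤ C₂ * (2 * moranLength a b v m / ((1 - B) * moranLength a b v n)) ^ d := hball
    _ = C₂ * (2 / (1 - B)) ^ d * (moranLength a b v m / moranLength a b v n) ^ d := by
        rw [mul_div_mul_comm, Real.mul_rpow (by positivity) (by positivity), mul_assoc]

theorem IsLowerPhiBound.exists_le_moranMass_div (hA : 0 < A) (hB : B < 1)
    (hab : ∀ n, (a n, b n) ∈ ratioRegion A B) (hp : ∀ n, p n ∈ Set.Ioo 0 1)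
    (h : IsLowerPhiBound (fun _ => 0) (moranMeasure a b p) d) :
    ∃ C > 0, ∃ K N, ∀ v m k, N ≤ m → K ≤ k →
      C * (moranLength a b v m / moranLength a b v (m + k)) ^ d ≤
        moranMass p v m / moranMass p v (m + k) := by
  obtain ⟨C₁, hC₁, C₂, hC₂, h⟩ := isLowerPhiBound_zero_iff.1 h
  have hB' : 0 < 1 - B := sub_pos.2 hB
  obtain ⟨N, hN⟩ := exists_moranLength_lt hA hB hab (lt_min hC₁ one_pos)
  obtain ⟨K, hK⟩ := exists_pow_lt_of_lt_one (half_pos hB') hB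
  refine ⟨C₂ * ((1 - B) / 2) ^ d, by positivity, K, N, fun v m k hm hk => ?_⟩
  have hB0 := ratioRegion_bound_pos hA (hab 0)
  have hlm := moranLength_pos hA hab v m
  have hln := moranLength_pos hA hab v (m + k)
  have hsmall : (1 - B) * moranLength a b v m < min C₁ 1 := by nlinarith [hN v m hm]
  have hrR : 2 * moranLength a b v (m + k) < (1 - B) * moranLength a b v m := by
    nlinarith [moranLength_add_le hA hab v m k, pow_le_pow_of_le_one hB0.le hB.le hk]
  have hball := h _ _ (by positivity) hrR (hsmall.le.trans (min_le_left _ _))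
    (hsmall.trans_le (min_le_right _ _)) _ ((support_moranMeasure hA hB hab hp).ge ⟨v, rfl⟩)
  calc C₂ * ((1 - B) / 2) ^ d * (moranLength a b v m / moranLength a b v (m + k)) ^ d
      = C₂ * ((1 - B) * moranLength a b v m / (2 * moranLength a b v (m + k))) ^ d := by
        rw [mul_div_mul_comm, Real.mul_rpow (by positivity) (by positivity), mul_assoc]
    _ ≤ _ := hball
    _ ≤ moranMass p v m / moranMass p v (m + k) := div_le_div₀ (moranMass_pos hp v m).le
        ((measureReal_ball_le_moranMass_succ hA hB hab le_rfl).trans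
          (moranMass_antitone p v m.le_succ))
        (moranMass_pos hp v _)
        (moranMass_le_measureReal_ball hA hB hab (lt_mul_of_one_lt_left hln one_lt_two))

end SymbolicBounds

section Dimensions

variable {a b : ℕ → ℝ} {A B : ℝ} {p : ℕ → unitInterval} {d : ℝ}

theorem moranMass_div_le_rpow (hA : 0 < A) (hab : ∀ n, (a n, b n) ∈ ratioRegion A B)
    (hp : ∀ n, p n ∈ Set.Ioo 0 1) (h : ∀ c n, childRatio c (a n, b n) ^ d ≤ childWeight c (p n))
    (v : ℕ → Bool) {m n : ℕ} (hmn : m ≤ n) :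
    moranMass p v m / moranMass p v n ≤ (moranLength a b v m / moranLength a b v n) ^ d := by
  have hratio := fun i => childRatio_pos hA (hab i) (v i)
  rw [moranMass_div hp v hmn, moranLength_div hA hab v hmn,
    ← Real.finsetProd_rpow _ _ fun i _ => (inv_pos.2 (hratio i)).le]
  refine Finset.prod_le_prod (fun i _ => (inv_pos.2 (childWeight_pos (hp i) _)).le) fun i _ => ?_
  rw [Real.inv_rpow (hratio i).le]
  exact inv_anti₀ (Real.rpow_pos_of_pos (hratio i) d) (h _ i)

theorem rpow_le_moranMass_div (hA : 0 < A) (hab : ∀ n, (a n, b n) ∈ ratioRegion A B)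
    (hp : ∀ n, p n ∈ Set.Ioo 0 1) (h : ∀ c n, childWeight c (p n) ≤ childRatio c (a n, b n) ^ d)
    (v : ℕ → Bool) {m n : ℕ} (hmn : m ≤ n) :
    (moranLength a b v m / moranLength a b v n) ^ d ≤ moranMass p v m / moranMass p v n := by
  have hratio := fun i => inv_pos.2 (childRatio_pos hA (hab i) (v i))
  rw [moranMass_div hp v hmn, moranLength_div hA hab v hmn,
    ← Real.finsetProd_rpow _ _ fun i _ => (hratio i).le]
  refine Finset.prod_le_prod (fun i _ => Real.rpow_nonneg (hratio i).le d) fun i _ => ?_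
  rw [Real.inv_rpow (childRatio_pos hA (hab i) _).le]
  exact inv_anti₀ (childWeight_pos (hp i) _) (h _ i)

theorem IsUpperPhiBound.rpow_le_of_isThick (hA : 0 < A) (hB : B < 1)
    (hab : ∀ n, (a n, b n) ∈ ratioRegion A B) (hp : ∀ n, p n ∈ Set.Ioo 0 1) (hd : 0 ≤ d)
    (h : IsUpperPhiBound (fun _ => 0) (moranMeasure a b p) d) {c : Bool} {s t : ℝ} (ht : 0 < t)
    (hthick : IsThick {n | t ≤ childRatio c (a n, b n) ∧ childWeight c (p n) ≤ s}) :
    t ^ d ≤ s := by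
  obtain ⟨C, hC, N, hCN⟩ := h.exists_moranMass_div_le hA hB hab hp
  have hs : 0 < s := hthick.nonempty.elim fun n hn => (childWeight_pos (hp n) c).trans_le hn.2
  suffices s⁻¹ ≤ t⁻¹ ^ d by
    rwa [Real.inv_rpow ht.le, inv_le_inv₀ hs (Real.rpow_pos_of_pos ht d)] at this
  refine le_of_forall_pow_le_mul_pow (C := C) (K := 0) (by positivity) fun k _ => ?_
  obtain ⟨n, hn, hrun⟩ := hthick.exists_ge k N
  have hle := Nat.le_add_right n k
  calc s⁻¹ ^ k ≤ ∏ i ∈ Finset.Ico n (n + k), (childWeight c (p i))⁻¹ :=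
        pow_le_prod_Ico_add (by positivity) fun i hi =>
          inv_anti₀ (childWeight_pos (hp i) c) (hrun hi).2
    _ = moranMass p (fun _ => c) n / moranMass p (fun _ => c) (n + k) :=
        (moranMass_div hp (fun _ => c) hle).symm
    _ ≤ C * (moranLength a b (fun _ => c) n / moranLength a b (fun _ => c) (n + k)) ^ d :=
        hCN _ _ _ hn hle
    _ ≤ C * (t⁻¹ ^ k) ^ d := by
        rw [moranLength_div hA hab _ hle]
        have hinv := fun i => inv_pos.2 (childRatio_pos hA (hab i) c)
        have hprod : ∏ i ∈ Finset.Ico n (n + k), (childRatio c (a i, b i))⁻¹ ≤ t⁻¹ ^ k :=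
          prod_Ico_add_le_pow (fun i => (hinv i).le) fun i hi => inv_anti₀ ht (hrun hi).1
        exact mul_le_mul_of_nonneg_left
          (Real.rpow_le_rpow (Finset.prod_nonneg fun i _ => (hinv i).le) hprod hd) hC.le
    _ = C * (t⁻¹ ^ d) ^ k := by rw [Real.rpow_pow_comm (by positivity)]

theorem IsLowerPhiBound.le_rpow_of_isThick (hA : 0 < A) (hB : B < 1)
    (hab : ∀ n, (a n, b n) ∈ ratioRegion A B) (hp : ∀ n, p n ∈ Set.Ioo 0 1) (hd : 0 ≤ d)
    (h : IsLowerPhiBound (fun _ => 0) (moranMeasure a b p) d) {c : Bool} {s t : ℝ} (hs : 0 < s)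
    (hthick : IsThick {n | s ≤ childWeight c (p n) ∧ childRatio c (a n, b n) ≤ t}) :
    s ≤ t ^ d := by
  obtain ⟨C, hC, K, N, hCN⟩ := h.exists_le_moranMass_div hA hB hab hp
  have ht : 0 < t := hthick.nonempty.elim fun n hn => (childRatio_pos hA (hab n) c).trans_le hn.2
  suffices t⁻¹ ^ d ≤ s⁻¹ by
    rwa [Real.inv_rpow ht.le, inv_le_inv₀ (Real.rpow_pos_of_pos ht d) hs] at this
  refine le_of_forall_pow_le_mul_pow (C := C⁻¹) (K := K) (by positivity) fun k hk => ?_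
  rw [le_inv_mul_iff₀ hC]
  obtain ⟨n, hn, hrun⟩ := hthick.exists_ge k N
  have hle := Nat.le_add_right n k
  calc C * (t⁻¹ ^ d) ^ k = C * (t⁻¹ ^ k) ^ d := by rw [Real.rpow_pow_comm (by positivity)]
    _ ≤ C * (moranLength a b (fun _ => c) n / moranLength a b (fun _ => c) (n + k)) ^ d := by
        rw [moranLength_div hA hab _ hle]
        have hprod : t⁻¹ ^ k ≤ ∏ i ∈ Finset.Ico n (n + k), (childRatio c (a i, b i))⁻¹ :=
          pow_le_prod_Ico_add (by positivity) fun i hi =>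
            inv_anti₀ (childRatio_pos hA (hab i) c) (hrun hi).2
        exact mul_le_mul_of_nonneg_left (Real.rpow_le_rpow (by positivity) hprod hd) hC.le
    _ ≤ moranMass p (fun _ => c) n / moranMass p (fun _ => c) (n + k) := hCN _ _ _ hn hk
    _ = ∏ i ∈ Finset.Ico n (n + k), (childWeight c (p i))⁻¹ := moranMass_div hp (fun _ => c) hle
    _ ≤ s⁻¹ ^ k := prod_Ico_add_le_pow (fun i => (inv_pos.2 (childWeight_pos (hp i) c)).le)
        fun i hi => inv_anti₀ hs (hrun hi).1

variable {s t : Bool → ℝ}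

theorem isUpperPhiBound_moranMeasure_iff (hA : 0 < A) (hB : B < 1)
    (hab : ∀ n, (a n, b n) ∈ ratioRegion A B) (hp : ∀ n, p n ∈ Set.Ioo 0 1) (hd : 0 ≤ d)
    (ht : ∀ c n, childRatio c (a n, b n) ≤ t c) (hs : ∀ c n, s c ≤ childWeight c (p n))
    (hthick : ∀ c, ∀ ε > 0,
      IsThick {n | t c - ε ≤ childRatio c (a n, b n) ∧ childWeight c (p n) ≤ s c + ε}) :
    IsUpperPhiBound (fun _ => 0) (moranMeasure a b p) d ↔ ∀ c, t c ^ d ≤ s c := by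
  refine ⟨fun h c => ?_, fun h => isUpperPhiBound_of_moranMass_div_le hA hB hab hp hd
    fun v m n hmn => moranMass_div_le_rpow hA hab hp (fun c n => ?_) v hmn⟩
  · have ht0 : 0 < t c := (childRatio_pos hA (hab 0) c).trans_le (ht c 0)
    have ht' : Tendsto (fun ε => t c - ε) (𝓝[>] 0) (𝓝 (t c)) :=
      ((continuous_sub_left (t c)).tendsto' 0 _ (sub_zero _)).mono_left nhdsWithin_le_nhds
    have hs' : Tendsto (fun ε => s c + ε) (𝓝[>] 0) (𝓝 (s c)) :=
      ((continuous_const_add (s c)).tendsto' 0 _ (add_zero _)).mono_left nhdsWithin_le_nhds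
    refine le_of_tendsto_of_tendsto (ht'.rpow_const (.inr hd)) hs' ?_
    filter_upwards [self_mem_nhdsWithin, ht'.eventually_const_lt ht0] with ε hε hpos
    exact h.rpow_le_of_isThick hA hB hab hp hd hpos (hthick c ε hε)
  · exact (Real.rpow_le_rpow (childRatio_pos hA (hab n) c).le (ht c n) hd).trans
      ((h c).trans (hs c n))

theorem isLowerPhiBound_moranMeasure_iff (hA : 0 < A) (hB : B < 1)
    (hab : ∀ n, (a n, b n) ∈ ratioRegion A B) (hp : ∀ n, p n ∈ Set.Ioo 0 1) (hd : 0 ≤ d)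
    (ht0 : ∀ c, 0 < t c) (ht : ∀ c n, t c ≤ childRatio c (a n, b n))
    (hs : ∀ c n, childWeight c (p n) ≤ s c)
    (hthick : ∀ c, ∀ ε > 0,
      IsThick {n | s c - ε ≤ childWeight c (p n) ∧ childRatio c (a n, b n) ≤ t c + ε}) :
    IsLowerPhiBound (fun _ => 0) (moranMeasure a b p) d ↔ ∀ c, s c ≤ t c ^ d := by
  refine ⟨fun h c => ?_, fun h => isLowerPhiBound_of_le_moranMass_div hA hB hab hp hd
    fun v m n hmn => rpow_le_moranMass_div hA hab hp (fun c n => ?_) v hmn⟩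
  · have hs0 : 0 < s c := (childWeight_pos (hp 0) c).trans_le (hs c 0)
    have ht' : Tendsto (fun ε => t c + ε) (𝓝[>] 0) (𝓝 (t c)) :=
      ((continuous_const_add (t c)).tendsto' 0 _ (add_zero _)).mono_left nhdsWithin_le_nhds
    have hs' : Tendsto (fun ε => s c - ε) (𝓝[>] 0) (𝓝 (s c)) :=
      ((continuous_sub_left (s c)).tendsto' 0 _ (sub_zero _)).mono_left nhdsWithin_le_nhds
    refine le_of_tendsto_of_tendsto hs' (ht'.rpow_const (.inr hd)) ?_
    filter_upwards [self_mem_nhdsWithin, hs'.eventually_const_lt hs0] with ε hε hpos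
    exact h.le_rpow_of_isThick hA hB hab hp hd hpos (hthick c ε hε)
  · exact (hs c n).trans ((h c).trans (Real.rpow_le_rpow (ht0 c).le (ht c n) hd))

theorem upperAssouadDim_moranMeasure (hA : 0 < A) (hB : B < 1)
    (hab : ∀ n, (a n, b n) ∈ ratioRegion A B) (hp : ∀ n, p n ∈ Set.Ioo 0 1)
    (ht : ∀ c n, childRatio c (a n, b n) ≤ t c) (hs : ∀ c n, s c ≤ childWeight c (p n))
    (hthick : ∀ c, ∀ ε > 0,
      IsThick {n | t c - ε ≤ childRatio c (a n, b n) ∧ childWeight c (p n) ≤ s c + ε}) :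
    upperAssouadDim (moranMeasure a b p) =
      open Classical in
      if s false = 0 ∨ s true = 0 then ⊤
      else ((max (Real.logb (t false) (s false)) (Real.logb (t true) (s true)) : ℝ) : EReal) := by
  have hiff := fun d hd => isUpperPhiBound_moranMeasure_iff (d := d) hA hB hab hp hd ht hs hthick
  have ht0 : ∀ c, 0 < t c := fun c => (childRatio_pos hA (hab 0) c).trans_le (ht c 0)
  have ht1 : ∀ c, t c < 1 := fun c => (le_of_forall_pos_le_add fun ε hε =>
    have ⟨n, hn⟩ := (hthick c ε hε).nonempty
    sub_le_iff_le_add.1 (hn.1.trans (childRatio_mem_Icc (hab n) c).2)).trans_lt hB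
  have hs0 : ∀ c, 0 ≤ s c := fun c => le_of_forall_pos_le_add fun ε hε =>
    have ⟨n, hn⟩ := (hthick c ε hε).nonempty
    (childWeight_mem_Icc c (p n)).1.trans hn.2
  have hs1 : ∀ c, s c < 1 := fun c => (hs c 0).trans_lt (childWeight_lt_one (hp 0) c)
  split_ifs with hzero
  · obtain ⟨c, hc⟩ : ∃ c, s c = 0 := Bool.exists_bool.2 hzero
    exact upperPhiDim_eq_top fun d hd h =>
      (Real.rpow_pos_of_pos (ht0 c) d).not_ge (hc ▸ (hiff d hd).1 h c)
  · have hspos : ∀ c, 0 < s c := fun c =>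
      (hs0 c).lt_of_ne' fun hc => hzero (by cases c; exacts [.inl hc, .inr hc])
    have hlogb := Real.logb_pos_of_base_lt_one (ht0 false) (ht1 false) (hspos false) (hs1 false)
    refine upperPhiDim_eq_coe (lt_max_of_lt_left hlogb) fun d hd => ?_
    rw [hiff d hd, Bool.forall_bool, max_le_iff]
    simp only [Real.logb_le_iff_le_rpow_of_base_lt_one, ht0, ht1, hspos]

theorem lowerAssouadDim_moranMeasure (hA : 0 < A) (hB : B < 1)
    (hab : ∀ n, (a n, b n) ∈ ratioRegion A B) (hp : ∀ n, p n ∈ Set.Ioo 0 1)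
    (ht : ∀ c n, t c ≤ childRatio c (a n, b n)) (hs : ∀ c n, childWeight c (p n) ≤ s c)
    (hthick : ∀ c, ∀ ε > 0,
      IsThick {n | s c - ε ≤ childWeight c (p n) ∧ childRatio c (a n, b n) ≤ t c + ε}) :
    lowerAssouadDim (moranMeasure a b p) =
      (min (Real.logb (t false) (s false)) (Real.logb (t true) (s true)) : ℝ) := by
  have ht0 : ∀ c, 0 < t c := fun c => hA.trans_le <| le_of_forall_pos_le_add fun ε hε =>
    have ⟨n, hn⟩ := (hthick c ε hε).nonempty
    (childRatio_mem_Icc (hab n) c).1.trans hn.2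
  have ht1 : ∀ c, t c < 1 := fun c =>
    (ht c 0).trans_lt ((childRatio_mem_Icc (hab 0) c).2.trans_lt hB)
  have hs0 : ∀ c, 0 < s c := fun c => (childWeight_pos (hp 0) c).trans_le (hs c 0)
  have hs1 : ∀ c, s c ≤ 1 := fun c => le_of_forall_pos_le_add fun ε hε =>
    have ⟨n, hn⟩ := (hthick c ε hε).nonempty
    sub_le_iff_le_add.1 (hn.1.trans (childWeight_mem_Icc c (p n)).2)
  have hlogb := fun c => Real.logb_nonneg_of_base_lt_one (ht0 c) (ht1 c) (hs0 c) (hs1 c)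
  refine lowerPhiDim_eq_coe (le_min (hlogb false) (hlogb true)) fun d hd => ?_
  rw [isLowerPhiBound_moranMeasure_iff hA hB hab hp hd ht0 ht hs hthick, Bool.forall_bool,
    le_min_iff]
  simp only [Real.le_logb_iff_rpow_le_of_base_lt_one, ht0, ht1, hs0]

end Dimensions

section IndependentEvents

variable {Ω : Type*} [MeasurableSpace Ω] {P : Measure Ω}

theorem iIndepSet_biInter_of_pairwise_disjoint {ι κ : Type*} {E : κ → Set Ω} {S : ι → Finset κ}
    (hE : ∀ i, MeasurableSet (E i)) (hind : iIndepSet E P)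
    (hS : Pairwise (Function.onFun Disjoint S)) : iIndepSet (fun j => ⋂ i ∈ S j, E i) P := by
  classical
  rw [iIndepSet_iff_meas_biInter fun j => (S j).measurableSet_biInter fun i _ => hE i]
  intro T
  rw [← Finset.set_biInter_biUnion, hind.meas_biInter, Finset.prod_biUnion (hS.set_pairwise _)]
  simp only [hind.meas_biInter]

theorem iIndepSet_preimage_inter_preimage {ι : Type*} {α β : ι → Type*}
    [∀ i, MeasurableSpace (α i)] [∀ i, MeasurableSpace (β i)]
    {X : ∀ i, Ω → α i} {Y : ∀ i, Ω → β i} (hX : ∀ i, Measurable (X i)) (hY : ∀ i, Measurable (Y i))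
    (hXind : iIndepFun X P) (hYind : iIndepFun Y P)
    (hXY : IndepFun (fun ω i => X i ω) (fun ω i => Y i ω) P)
    {U : ∀ i, Set (α i)} {V : ∀ i, Set (β i)}
    (hU : ∀ i, MeasurableSet (U i)) (hV : ∀ i, MeasurableSet (V i)) :
    iIndepSet (fun i => X i ⁻¹' U i ∩ Y i ⁻¹' V i) P := by
  have hmeas (T : Finset ι) : P (⋂ i ∈ T, (X i ⁻¹' U i ∩ Y i ⁻¹' V i)) =
      (∏ i ∈ T, P (X i ⁻¹' U i)) * ∏ i ∈ T, P (Y i ⁻¹' V i) := by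
    have h := hXY.measure_inter_preimage_eq_mul (Set.pi T U) (Set.pi T V)
      (.pi T.countable_toSet fun i _ => hU i) (.pi T.countable_toSet fun i _ => hV i)
    simp only [Set.pi_def, Set.preimage_iInter] at h
    simp only [Set.iInter_inter_distrib]
    rw [← hXind.measure_inter_preimage_eq_mul T fun i _ => hU i,
      ← hYind.measure_inter_preimage_eq_mul T fun i _ => hV i]
    exact h
  rw [iIndepSet_iff_meas_biInter fun i => (hX i (hU i)).inter (hY i (hV i))]
  intro T
  rw [hmeas, ← Finset.prod_mul_distrib]
  exact Finset.prod_congr rfl fun i _ => by simpa using (hmeas {i}).symm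

theorem ae_isThick_of_iIndepSet {E : ℕ → Set Ω} (hE : ∀ n, MeasurableSet (E n))
    (hind : iIndepSet E P) {δ : ENNReal} (hδ : δ ≠ 0) (hP : ∀ n, δ ≤ P (E n)) :
    ∀ᵐ ω ∂P, IsThick {n | ω ∈ E n} := by
  have := hind.isProbabilityMeasure
  refine ae_all_iff.2 fun k => ?_
  let F : ℕ → Set Ω := fun j => ⋂ i ∈ Finset.Ico (j * k) ((j + 1) * k), E i
  have hF : ∀ j, MeasurableSet (F j) := fun j => Finset.measurableSet_biInter _ fun i _ => hE i
  have hFind : iIndepSet F P := by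
    refine iIndepSet_biInter_of_pairwise_disjoint hE hind fun i j hij => ?_
    rw [Function.onFun, ← Finset.disjoint_coe, Finset.coe_Ico, Finset.coe_Ico]
    exact Monotone.pairwise_disjoint_on_Ico_succ (fun _ _ h => Nat.mul_le_mul_right k h) hij
  have hFP (j : ℕ) : δ ^ k ≤ P (F j) := by
    rw [hind.meas_biInter]
    simpa [← Nat.sub_mul] using
      Finset.pow_card_le_prod (Finset.Ico (j * k) ((j + 1) * k)) _ δ fun i _ => hP i
  have hsum : ∑' j, P (F j) = ⊤ := top_unique <|
    (ENNReal.tsum_const_eq_top_of_ne_zero (pow_ne_zero k hδ)).ge.trans (ENNReal.tsum_le_tsum hFP)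
  have hlim : ∀ᵐ ω ∂P, ω ∈ limsup F atTop :=
    (mem_ae_iff_prob_eq_one (.measurableSet_limsup hF)).2 (measure_limsup_eq_one hF hFind hsum)
  filter_upwards [hlim] with ω hω
  obtain ⟨j, hj⟩ := (mem_limsup_iff_frequently_mem.1 hω).exists
  refine ⟨j * k, fun i hi => Set.mem_iInter₂.1 hj i (Finset.mem_Ico.2 ?_)⟩
  rwa [Nat.succ_mul]

theorem ae_isThick_of_iIndepFun_of_indepFun {α β : Type*} [MeasurableSpace α] [MeasurableSpace β]
    {X : ℕ → Ω → α} {Y : ℕ → Ω → β} (hX : ∀ n, Measurable (X n)) (hY : ∀ n, Measurable (Y n))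
    (hXind : iIndepFun X P) (hXident : ∀ n, IdentDistrib (X n) (X 0) P P)
    (hYind : iIndepFun Y P) (hYident : ∀ n, IdentDistrib (Y n) (Y 0) P P)
    (hXY : IndepFun (fun ω n => X n ω) (fun ω n => Y n ω) P)
    {U : Set α} {V : Set β} (hU : MeasurableSet U) (hV : MeasurableSet V)
    (hPU : P (X 0 ⁻¹' U) ≠ 0) (hPV : P (Y 0 ⁻¹' V) ≠ 0) :
    ∀ᵐ ω ∂P, IsThick {n | X n ω ∈ U ∧ Y n ω ∈ V} := by
  refine ae_isThick_of_iIndepSet (fun n => (hX n hU).inter (hY n hV))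
    (iIndepSet_preimage_inter_preimage hX hY hXind hYind hXY (fun _ => hU) fun _ => hV)
    (mul_ne_zero hPU hPV) fun n => ?_
  have hXYn : IndepFun (X n) (Y n) P := hXY.comp (measurable_pi_apply n) (measurable_pi_apply n)
  rw [← (hXident n).measure_preimage_eq hU, ← (hYident n).measure_preimage_eq hV]
  exact (hXYn.measure_inter_preimage_eq_mul U V hU hV).ge

end IndependentEvents

section EssentialBounds

variable {Ω : Type*} [MeasurableSpace Ω] {P : Measure Ω}

theorem measure_lt_essInf_add_ne_zero {f : Ω → ℝ} (hf : IsCoboundedUnder (· ≥ ·) (ae P) f)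
    {ε : ℝ} (hε : 0 < ε) : P {ω | f ω < essInf f P + ε} ≠ 0 :=
  frequently_ae_iff.1 (frequently_lt_of_liminf_lt hf (lt_add_of_pos_right _ hε))

theorem measure_essSup_sub_lt_ne_zero {f : Ω → ℝ} (hf : IsCoboundedUnder (· ≤ ·) (ae P) f)
    {ε : ℝ} (hε : 0 < ε) : P {ω | essSup f P - ε < f ω} ≠ 0 :=
  frequently_ae_iff.1 (frequently_lt_of_lt_limsup hf (sub_lt_self _ hε))

theorem ae_forall_mem_Icc_essInf_essSup {ι α : Type*} [Countable ι] [MeasurableSpace α]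
    {X : ι → Ω → α} {i₀ : ι} (hX : ∀ i, IdentDistrib (X i) (X i₀) P P) {f : α → ℝ}
    (hf : Measurable f) {m M : ℝ} (hmM : ∀ ω, f (X i₀ ω) ∈ Set.Icc m M) :
    ∀ᵐ ω ∂P, ∀ i, f (X i ω) ∈
      Set.Icc (essInf (fun ω => f (X i₀ ω)) P) (essSup (fun ω => f (X i₀ ω)) P) := by
  refine ae_all_iff.2 fun i => (hX i).symm.ae_mem_snd (hf measurableSet_Icc) ?_
  filter_upwards [ae_essInf_le (isBoundedUnder_of ⟨m, fun ω => (hmM ω).1⟩),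
    ae_le_essSup (isBoundedUnder_of ⟨M, fun ω => (hmM ω).2⟩)] with ω h₁ h₂ using ⟨h₁, h₂⟩

theorem ae_forall_isThick_near_essSup_essInf {α β : Type*} [MeasurableSpace α] [MeasurableSpace β]
    {X : ℕ → Ω → α} {Y : ℕ → Ω → β} (hX : ∀ n, Measurable (X n)) (hY : ∀ n, Measurable (Y n))
    (hXind : iIndepFun X P) (hXident : ∀ n, IdentDistrib (X n) (X 0) P P)
    (hYind : iIndepFun Y P) (hYident : ∀ n, IdentDistrib (Y n) (Y 0) P P)
    (hXY : IndepFun (fun ω n => X n ω) (fun ω n => Y n ω) P)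
    {f : α → ℝ} {g : β → ℝ} (hf : Measurable f) (hg : Measurable g)
    (hfbdd : IsCoboundedUnder (· ≤ ·) (ae P) fun ω => f (X 0 ω))
    (hgbdd : IsCoboundedUnder (· ≥ ·) (ae P) fun ω => g (Y 0 ω)) :
    ∀ᵐ ω ∂P, ∀ ε > 0, IsThick {n | essSup (fun ω => f (X 0 ω)) P - ε ≤ f (X n ω) ∧
      g (Y n ω) ≤ essInf (fun ω => g (Y 0 ω)) P + ε} := by
  set t := essSup (fun ω => f (X 0 ω)) P
  set s := essInf (fun ω => g (Y 0 ω)) P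
  have hthick (m : ℕ) : ∀ᵐ ω ∂P, IsThick
      {n | t - 1 / (m + 1) < f (X n ω) ∧ g (Y n ω) < s + 1 / (m + 1)} :=
    ae_isThick_of_iIndepFun_of_indepFun hX hY hXind hXident hYind hYident hXY
      (hf measurableSet_Ioi) (hg measurableSet_Iio)
      (measure_essSup_sub_lt_ne_zero hfbdd Nat.one_div_pos_of_nat)
      (measure_lt_essInf_add_ne_zero hgbdd Nat.one_div_pos_of_nat)
  filter_upwards [ae_all_iff.2 hthick] with ω hω ε hε
  obtain ⟨m, hm⟩ := exists_nat_one_div_lt hε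
  exact (hω m).mono fun n hn =>
    ⟨(sub_le_sub_left hm.le t).trans hn.1.le, hn.2.le.trans (add_le_add_right hm.le s)⟩

theorem ae_pos_of_lintegral_rpow_neg_lt_top {f : Ω → ℝ} (hf : AEMeasurable f P) {t : ℝ}
    (ht : 0 < t) (h : ∫⁻ ω, ENNReal.ofReal (f ω) ^ (-t) ∂P < ⊤) : ∀ᵐ ω ∂P, 0 < f ω := by
  filter_upwards [ae_lt_top' (by fun_prop) h.ne] with ω hω
  by_contra! hle
  rw [ENNReal.ofReal_of_nonpos hle, ENNReal.zero_rpow_of_neg (neg_lt_zero.2 ht)] at hω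
  exact hω.false

end EssentialBounds

theorem mainTheorem7_general {Ω : Type*} [MeasurableSpace Ω] (P : Measure Ω)
    [IsProbabilityMeasure P] (A B : ℝ) (hA : 0 < A) (hB : B < 1)
    (a b : ℕ → Ω → ℝ) (p : ℕ → Ω → unitInterval)
    (ha : ∀ n, Measurable (a n)) (hb : ∀ n, Measurable (b n)) (hp : ∀ n, Measurable (p n))
    (hab : ∀ n ω, (a n ω, b n ω) ∈ ratioRegion A B)
    (hab_indep : iIndepFun (fun n ω => (a n ω, b n ω)) P)
    (hab_ident : ∀ n, IdentDistrib (fun ω => (a n ω, b n ω)) (fun ω => (a 0 ω, b 0 ω)) P P)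
    (hp_indep : iIndepFun p P)
    (hp_ident : ∀ n, IdentDistrib (p n) (p 0) P P)
    (h_indep : IndepFun (fun ω n => (a n ω, b n ω)) (fun ω n => p n ω) P)
    (hp_Ioo : ∀ᵐ ω ∂P, p 0 ω ∈ Set.Ioo 0 1) :
    ∀ᵐ ω ∂P,
      upperAssouadDim (moranMeasure (fun n => a n ω) (fun n => b n ω) (fun n => p n ω)) =
          moranAlpha P (a 0) (b 0) (p 0) ∧
        lowerAssouadDim (moranMeasure (fun n => a n ω) (fun n => b n ω) (fun n => p n ω)) =
          (moranBeta P (a 0) (b 0) (p 0) : EReal) := by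
  have hX : ∀ n, Measurable fun ω => (a n ω, b n ω) := fun n => (ha n).prodMk (hb n)
  have hratio := fun c ω => childRatio_mem_Icc (hab 0 ω) c
  have hweight := fun c ω => childWeight_mem_Icc c (p 0 ω)
  have hIoo : ∀ᵐ ω ∂P, ∀ n, p n ω ∈ Set.Ioo 0 1 :=
    ae_all_iff.2 fun n => (hp_ident n).symm.ae_mem_snd measurableSet_Ioo hp_Ioo
  have hratio_ess := ae_all_iff.2 fun c =>
    ae_forall_mem_Icc_essInf_essSup hab_ident (measurable_childRatio c) (hratio c)
  have hweight_ess := ae_all_iff.2 fun c =>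
    ae_forall_mem_Icc_essInf_essSup hp_ident (measurable_childWeight c) (hweight c)
  have hupper := ae_all_iff.2 fun c =>
    ae_forall_isThick_near_essSup_essInf hX hp hab_indep hab_ident hp_indep hp_ident h_indep
      (measurable_childRatio c) (measurable_childWeight c)
      (isBoundedUnder_of ⟨A, fun ω => (hratio c ω).1⟩).isCoboundedUnder_le
      (isBoundedUnder_of ⟨1, fun ω => (hweight c ω).2⟩).isCoboundedUnder_ge
  have hlower := ae_all_iff.2 fun c =>
    ae_forall_isThick_near_essSup_essInf hp hX hp_indep hp_ident hab_indep hab_ident h_indep.symm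
      (measurable_childWeight c) (measurable_childRatio c)
      (isBoundedUnder_of ⟨0, fun ω => (hweight c ω).1⟩).isCoboundedUnder_le
      (isBoundedUnder_of ⟨B, fun ω => (hratio c ω).2⟩).isCoboundedUnder_ge
  filter_upwards [hIoo, hratio_ess, hweight_ess, hupper, hlower] with ω hω hr hw hu hl
  exact ⟨upperAssouadDim_moranMeasure hA hB (hab · ω) hω (fun c n => (hr c n).2)
      (fun c n => (hw c n).1) hu,
    lowerAssouadDim_moranMeasure hA hB (hab · ω) hω (fun c n => (hr c n).1)
      (fun c n => (hw c n).2) hl⟩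

theorem mainTheorem7 {Ω : Type*} [MeasurableSpace Ω] (P : Measure Ω) [IsProbabilityMeasure P]
    (A B : ℝ) (hA : 0 < A) (hAB : A < B) (hB : B < 1)
    (a b : ℕ → Ω → ℝ) (p : ℕ → Ω → unitInterval)
    -- measurability, and the admissible range of the ratios
    (ha : ∀ n, Measurable (a n)) (hb : ∀ n, Measurable (b n)) (hp : ∀ n, Measurable (p n))
    (hab : ∀ n ω, (a n ω, b n ω) ∈ ratioRegion A B)
    -- the pairs of ratios are independent and identically distributed
    (hab_indep : iIndepFun (fun n ω => (a n ω, b n ω)) P)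
    (hab_ident : ∀ n, IdentDistrib (fun ω => (a n ω, b n ω)) (fun ω => (a 0 ω, b 0 ω)) P P)
    -- so are the probabilities
    (hp_indep : iIndepFun p P)
    (hp_ident : ∀ n, IdentDistrib (p n) (p 0) P P)
    -- the probabilities are independent of the ratios
    (h_indep : IndepFun (fun ω n => (a n ω, b n ω)) (fun ω n => p n ω) P)
    -- finite negative moments of the ratios and of the probabilities (`0 ^ (-t) = ∞`)
    (hab_mom : ∃ t : ℝ, 0 < t ∧ ∫⁻ ω, ENNReal.ofReal (a 0 ω) ^ (-t) ∂P < ⊤ ∧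
      ∫⁻ ω, ENNReal.ofReal (b 0 ω) ^ (-t) ∂P < ⊤)
    (hp_mom : ∃ t : ℝ, 0 < t ∧ ∫⁻ ω, ENNReal.ofReal (p 0 ω : ℝ) ^ (-t) ∂P < ⊤ ∧
      ∫⁻ ω, ENNReal.ofReal (1 - (p 0 ω : ℝ)) ^ (-t) ∂P < ⊤) :
    ∀ᵐ ω ∂P,
      upperAssouadDim (moranMeasure (fun n => a n ω) (fun n => b n ω) (fun n => p n ω)) =
          moranAlpha P (a 0) (b 0) (p 0) ∧
        lowerAssouadDim (moranMeasure (fun n => a n ω) (fun n => b n ω) (fun n => p n ω)) =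
          (moranBeta P (a 0) (b 0) (p 0) : EReal) := by
  obtain ⟨t, ht, hp₀, hp₁⟩ := hp_mom
  have hpm : Measurable fun ω => (p 0 ω : ℝ) := measurable_subtype_coe.comp (hp 0)
  refine mainTheorem7_general P A B hA hB a b p ha hb hp hab hab_indep hab_ident hp_indep hp_ident
    h_indep ?_
  filter_upwards [ae_pos_of_lintegral_rpow_neg_lt_top hpm.aemeasurable ht hp₀,
    ae_pos_of_lintegral_rpow_neg_lt_top (hpm.const_sub 1).aemeasurable ht hp₁] with ω h₀ h₁
  have h_lt : (p 0 ω : ℝ) < 1 := sub_pos.1 h₁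
  exact ⟨h₀, h_lt⟩
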